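/- Let $F$ be a field of prime characteristic $p$, $G$ a group, and $V$ a finite-dimensional $FG$-module. Let $T(V)=\bigoplus_{r\ge 0}T^r(V)$ be the tensor algebra (the free associative algebra on $V$), with $T^1(V)=V$ and with $G$ acting by the algebra automorphisms that extend its action on $V$. For an $FG$-submodule $B$ of some $T^r(V)$ with $r\ge 1$ (in particular for $B=V$) let $T^n(B)$ be the span of all products of $n$ elements of $B$, let $L(B)$ be the Lie subalgebra of $T(V)$ generated by $B$ (with $[a,b]=ab-ba$), and let $R(B)$ be the restricted Lie subalgebra of $T(V)$ generated by $B$ (with $p$-operation $a\mapsto a^p$). For $n\ge 1$ put $L^n(B)=L(B)\cap T^n(B)$ and $R^n(B)=R(B)\cap T^n(B)$; these are $FG$-submodules of $T(V)$. Let $(B_r)_{r\ge 1}$ be any family of modules as in the Decomposition Theorem, that is: for each $r\ge 1$, $B_r$ is an $FG$-submodule of $L^r(V)$ which is a direct summand of the $FG$-module $T^r(V)$, and for every positive integer $k$ not divisible by $p$ and every $m\ge 0$, $$L^{p^mk}(V)=L^{p^m}(B_k)\oplus L^{p^{m-1}}(B_{pk})\oplus\cdots\oplus L^1(B_{p^mk}).$$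 Then, for every positive integer $k$ not divisible by $p$ and every $m\ge 0$, there is an internal direct sum decomposition of $FG$-modules $$R^{p^mk}(V)=R^{p^m}(B_k)\oplus R^{p^{m-1}}(B_{pk})\oplus\cdots\oplus R^1(B_{p^mk}).$$ -/

import Mathlib

namespace LiePowers

-- the commutator bracket `ab - ba` on an associative ring
attribute [local instance] LieRing.ofAssociativeRing

section Algebra

variable {F A : Type*} [Field F] [Ring A] [Algebra F A]

/-- The restricted Lie subalgebra of the associative algebra `A` (bracket `ab - ba`,
`p`-operation `a ↦ a ^ p`) generated by `S`: the smallest Lie subalgebra that contains `S` and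
is closed under `p`-th powers. -/
def restrictedLieSpan (F : Type*) {A : Type*} [Field F] [Ring A] [Algebra F A]
    (p : ℕ) (S : Set A) : LieSubalgebra F A :=
  sInf {K : LieSubalgebra F A | S ⊆ K ∧ ∀ x ∈ K, x ^ p ∈ K}

theorem mem_restrictedLieSpan {p : ℕ} {S : Set A} {x : A} :
    x ∈ restrictedLieSpan F p S ↔
      ∀ K : LieSubalgebra F A, S ⊆ K → (∀ y ∈ K, y ^ p ∈ K) → x ∈ K := by
  rw [← SetLike.mem_coe, restrictedLieSpan, LieSubalgebra.coe_sInf]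
  simp

/-- An algebra endomorphism mapping `S` into itself maps the Lie subalgebra generated by `S`
into itself. -/
theorem map_mem_lieSpan (f : A →ₐ[F] A) {S : Set A} (hS : ∀ x ∈ S, f x ∈ S) {x : A}
    (hx : x ∈ LieSubalgebra.lieSpan F A S) : f x ∈ LieSubalgebra.lieSpan F A S :=
  LieSubalgebra.mem_lieSpan.mp hx ((LieSubalgebra.lieSpan F A S).comap (f : A →ₗ⁅F⁆ A))
    fun y hy => LieSubalgebra.subset_lieSpan (hS y hy)

/-- An algebra endomorphism mapping `S` into itself maps the restricted Lie subalgebra generated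
by `S` into itself. -/
theorem map_mem_restrictedLieSpan (p : ℕ) (f : A →ₐ[F] A) {S : Set A} (hS : ∀ x ∈ S, f x ∈ S)
    {x : A} (hx : x ∈ restrictedLieSpan F p S) : f x ∈ restrictedLieSpan F p S := by
  refine mem_restrictedLieSpan.mp hx ((restrictedLieSpan F p S).comap (f : A →ₗ⁅F⁆ A)) ?_ ?_
  · exact fun y hy => mem_restrictedLieSpan.mpr fun K hK _ => hK (hS y hy)
  · intro y hy
    change f (y ^ p) ∈ restrictedLieSpan F p S
    rw [map_pow]
    refine mem_restrictedLieSpan.mpr fun K hK hp => hp _ ?_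
    exact mem_restrictedLieSpan.mp (show f y ∈ restrictedLieSpan F p S from hy) K hK hp

theorem map_mem_pow (f : A →ₐ[F] A) {B : Submodule F A} (hB : ∀ x ∈ B, f x ∈ B) (n : ℕ)
    {x : A} (hx : x ∈ B ^ n) : f x ∈ B ^ n := by
  have h : (B ^ n).map f.toLinearMap ≤ B ^ n := by
    rw [Submodule.map_pow]
    exact pow_le_pow_left' (Submodule.map_le_iff_le_comap.mpr hB) n
  exact h (Submodule.mem_map_of_mem hx)

end Algebra

section Representation

variable {F G V : Type*} [Field F] [Group G] [AddCommGroup V] [Module F V]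

/-- The action of `g` on `T(V)`: the algebra endomorphism extending the action on `V`. -/
noncomputable def tensorAction (ρ : Representation F G V) (g : G) :
    TensorAlgebra F V →ₐ[F] TensorAlgebra F V :=
  TensorAlgebra.lift F (TensorAlgebra.ι F ∘ₗ ρ g)

@[simp]
theorem tensorAction_ι (ρ : Representation F G V) (g : G) (v : V) :
    tensorAction ρ g (TensorAlgebra.ι F v) = TensorAlgebra.ι F (ρ g v) := by
  simp [tensorAction]

/-- `T(V)` as an `FG`-module, where `G` acts by algebra automorphisms extending the action
on `V`. -/
noncomputable def tensorRep (ρ : Representation F G V) :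
    Representation F G (TensorAlgebra F V) where
  toFun g := (tensorAction ρ g).toLinearMap
  map_one' := by
    have h : tensorAction ρ 1 = AlgHom.id F _ := by ext v; simp
    rw [h]; rfl
  map_mul' g h := by
    have e : tensorAction ρ (g * h) = (tensorAction ρ g).comp (tensorAction ρ h) := by
      ext v; simp
    rw [e]; rfl

variable {ρ : Representation F G V}

/-- For an `FG`-submodule `B` of `T(V)`, the component `Tⁿ(B)`: the span of all products of `n`
elements of `B`. -/
noncomputable def tensorPower (B : Subrepresentation (tensorRep ρ)) (n : ℕ) :
    Subrepresentation (tensorRep ρ) where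
  toSubmodule := B.toSubmodule ^ n
  apply_mem_toSubmodule g _ hv :=
    map_mem_pow (tensorAction ρ g) (fun _ hx => B.apply_mem_toSubmodule g hx) n hv

/-- For an `FG`-submodule `B` of `T(V)`, the Lie power `Lⁿ(B) = L(B) ∩ Tⁿ(B)`, where `L(B)` is the
Lie subalgebra of `T(V)` generated by `B`. -/
noncomputable def liePower (B : Subrepresentation (tensorRep ρ)) (n : ℕ) :
    Subrepresentation (tensorRep ρ) where
  toSubmodule :=
    (LieSubalgebra.lieSpan F (TensorAlgebra F V) (B : Set (TensorAlgebra F V))).toSubmodule ⊓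
      (tensorPower B n).toSubmodule
  apply_mem_toSubmodule g _ hv :=
    ⟨map_mem_lieSpan (tensorAction ρ g) (fun _ hx => B.apply_mem_toSubmodule g hx) hv.1,
      (tensorPower B n).apply_mem_toSubmodule g hv.2⟩

/-- For an `FG`-submodule `B` of `T(V)`, the restricted Lie power `Rⁿ(B) = R(B) ∩ Tⁿ(B)`, where
`R(B)` is the restricted Lie subalgebra of `T(V)` generated by `B`. -/
noncomputable def restrictedLiePower (p : ℕ) (B : Subrepresentation (tensorRep ρ)) (n : ℕ) :
    Subrepresentation (tensorRep ρ) where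
  toSubmodule :=
    (restrictedLieSpan F p (B : Set (TensorAlgebra F V))).toSubmodule ⊓
      (tensorPower B n).toSubmodule
  apply_mem_toSubmodule g _ hv :=
    ⟨map_mem_restrictedLieSpan p (tensorAction ρ g)
        (fun _ hx => B.apply_mem_toSubmodule g hx) hv.1,
      (tensorPower B n).apply_mem_toSubmodule g hv.2⟩

/-- The module `V` itself, identified with the degree one component of `T(V)`. -/
noncomputable def base (ρ : Representation F G V) : Subrepresentation (tensorRep ρ) where
  toSubmodule := LinearMap.range (TensorAlgebra.ι F : V →ₗ[F] TensorAlgebra F V)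
  apply_mem_toSubmodule g v hv := by
    obtain ⟨w, rfl⟩ := hv
    exact ⟨ρ g w, (tensorAction_ι ρ g w).symm⟩

/-- `M = ⨁ i, N i` as an internal direct sum of `FG`-submodules. -/
def IsDirectSumOf {W ι : Type*} [AddCommGroup W] [Module F W] {σ : Representation F G W}
    (M : Subrepresentation σ) (N : ι → Subrepresentation σ) : Prop :=
  iSupIndep (fun i => (N i).toSubmodule) ∧ (⨆ i, (N i).toSubmodule) = M.toSubmodule

/-- `N` is a direct summand of `M`, as `FG`-modules. -/
def IsDirectSummandOf {W : Type*} [AddCommGroup W] [Module F W] {σ : Representation F G W}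
    (N M : Subrepresentation σ) : Prop :=
  ∃ C : Subrepresentation σ, N ⊓ C = ⊥ ∧ N ⊔ C = M

/-- The defining properties of the family `B₁, B₂, …` of `FG`-submodules in a decomposition of
the Lie powers of `V` in characteristic `p` (`B 0` is irrelevant). -/
structure IsLieDecomposition (p : ℕ) (ρ : Representation F G V)
    (B : ℕ → Subrepresentation (tensorRep ρ)) : Prop where
  le_liePower : ∀ r : ℕ, 1 ≤ r → B r ≤ liePower (base ρ) r
  isDirectSummandOf : ∀ r : ℕ, 1 ≤ r → IsDirectSummandOf (B r) (tensorPower (base ρ) r)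
  isDirectSumOf : ∀ k m : ℕ, ¬ p ∣ k →
    IsDirectSumOf (liePower (base ρ) (p ^ m * k))
      (fun i : Fin (m + 1) => liePower (B (p ^ (i : ℕ) * k)) (p ^ (m - (i : ℕ))))

end Representation

end LiePowers

/-! Write L and R for the free Lie and free restricted Lie algebra on V inside T(V). In
characteristic p, brackets of elements of R lie in L, and by Jacobson's formula the p-th power map
is additive modulo L. Hence the degree n part of R equals that of L when p does not divide n, and in
degree pj it is the Lie part plus the span of the p-th powers of any spanning set in degree j. The
same holds for each submodule B in place of V, provided the powers of B are independent
(`restrictedComponent_eq_lieComponent`, `restrictedComponent_mul_le`). The theorem follows by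
induction on m: each old summand acquires p-th powers, and one new summand enters in degree one.
Spanning is additivity modulo L. Independence needs one more fact, `eq_zero_of_sum_pow_mem_lieSpan`:
p-th powers of independent elements of R of equal degree are independent modulo L. A relation among
the restricted summands then loses its p-th powers and becomes a relation among the Lie summands,
which are independent by hypothesis. That fact is proved by leading words. The smallest word of a
Lie element in a given degree is a Lyndon word (`isLyndon_of_hasLead`), whereas p-th powers produce
leading words of the form u^p, which are never Lyndon. -/

namespace LiePowers

attribute [local instance] LieRing.ofAssociativeRing

/-! ### Lexicographic order and Lyndon words -/

section Words

variable {X : Type*} [LinearOrder X]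

theorem append_left_lt_iff {a b c : List X} : a ++ b < a ++ c ↔ b < c := by
  induction a with
  | nil => simp
  | cons x a ih => simp [ih]

theorem lt_append_self {a b : List X} (hb : b ≠ []) : a < a ++ b := by
  conv_lhs => rw [← List.append_nil a]
  rw [append_left_lt_iff]
  cases b with
  | nil => exact absurd rfl hb
  | cons x b => simp

/-- A word smaller than `v` is either a proper prefix of `v` or stays smaller after arbitrary
extensions on both sides. -/
theorem prefix_or_append_lt {u v : List X} (h : u < v) :
    (∃ w, w ≠ [] ∧ v = u ++ w) ∨ ∀ x y, u ++ x < v ++ y := by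
  induction u generalizing v with
  | nil =>
    cases v with
    | nil => simp at h
    | cons b v => exact Or.inl ⟨b :: v, by simp, rfl⟩
  | cons a u ih =>
    cases v with
    | nil => simp at h
    | cons b v =>
      rcases List.cons_lt_cons_iff.mp h with h | ⟨rfl, hlt⟩
      · right
        intro x y
        exact List.cons_lt_cons_iff.mpr (Or.inl h)
      · rcases ih hlt with ⟨w, hw, rfl⟩ | h
        · exact Or.inl ⟨w, hw, rfl⟩
        · right
          intro x y
          exact List.cons_lt_cons_iff.mpr (Or.inr ⟨rfl, h x y⟩)

theorem append_lt_append_of_length_le {u v : List X} (h : u < v) (hl : v.length ≤ u.length)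
    (x y : List X) : u ++ x < v ++ y := by
  rcases prefix_or_append_lt h with ⟨w, hw, rfl⟩ | h
  · have := List.length_pos_of_ne_nil hw
    rw [List.length_append] at hl
    omega
  · exact h x y

/-- A Lyndon word: a nonempty word smaller than all its proper nonempty suffixes. -/
def IsLyndon (w : List X) : Prop :=
  w ≠ [] ∧ ∀ u v, u ≠ [] → v ≠ [] → w = u ++ v → w < v

theorem IsLyndon.append_lt_right {u v : List X} (hu : IsLyndon u) (hv : IsLyndon v) (h : u < v) :
    u ++ v < v := by
  rcases prefix_or_append_lt h with ⟨w, hw, rfl⟩ | h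
  · rw [append_left_lt_iff]
    exact hv.2 u w hu.1 hw rfl
  · simpa using h v []

/-- A suffix inside v is at least v, which exceeds uv. A suffix cv with c a proper suffix of u is
larger because u < c is already decided within the length of c. -/
theorem IsLyndon.append {u v : List X} (hu : IsLyndon u) (hv : IsLyndon v) (h : u < v) :
    IsLyndon (u ++ v) := by
  refine ⟨by simp [hu.1], fun a b ha hb hab => ?_⟩
  rcases List.append_eq_append_iff.mp hab with ⟨c, rfl, hc⟩ | ⟨c, hc, rfl⟩
  · rcases eq_or_ne c [] with rfl | hc0
    · rw [show b = v by simpa using hc.symm]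
      exact hu.append_lt_right hv h
    · exact (hu.append_lt_right hv h).trans (hv.2 c b hc0 hb hc)
  · rcases eq_or_ne c [] with rfl | hc0
    · simpa using hu.append_lt_right hv h
    · refine append_lt_append_of_length_le (hu.2 a c ha hc0 hc) ?_ _ _
      simp [hc]

/-- The proper suffix u is also a proper prefix, hence smaller than the whole word. -/
theorem not_isLyndon_flatten_replicate (u : List X) {n : ℕ} (hn : 2 ≤ n) :
    ¬ IsLyndon (List.replicate n u).flatten := by
  rintro ⟨h0, h⟩
  obtain ⟨k, rfl⟩ := Nat.exists_eq_add_of_le' hn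
  rcases eq_or_ne u [] with rfl | hu
  · simp at h0
  set q := (List.replicate (k + 1) u).flatten with hq
  have hq0 : q ≠ [] := by simp [hq, List.replicate_succ, hu]
  have e : (List.replicate (k + 2) u).flatten = q ++ u := by
    rw [hq, List.replicate_succ' (n := k + 1)]; simp
  have e' : q ++ u = u ++ q := by
    rw [← e, hq, List.replicate_succ (n := k + 1)]; simp
  have e'' : q = u ++ (List.replicate k u).flatten := by
    rw [hq, List.replicate_succ]; simp
  have := h q u hq0 hu e
  rw [e, e'] at this
  exact lt_asymm this (lt_append_self hq0)

end Words

/-! ### Hall trees and the standard factorization -/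

section HallTrees

variable {X : Type*}

/-- The word read off from the leaves of a tree. -/
def word : FreeMagma X → List X
  | .of a => [a]
  | .mul s t => word s ++ word t

@[simp]
theorem word_of (a : X) : word (.of a) = [a] := rfl

@[simp]
theorem word_mul (s t : FreeMagma X) : word (s * t) = word s ++ word t := rfl

theorem word_ne_nil (t : FreeMagma X) : word t ≠ [] := by
  induction t with
  | ih1 a => simp
  | ih2 s t hs ht => simp [hs]

variable [LinearOrder X]

/-- The Hall trees for the lexicographic order on words; their words are the Lyndon words with
their standard bracketing. -/
inductive IsHall : FreeMagma X → Prop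
  | of (a : X) : IsHall (.of a)
  | of_mul (a : X) (t : FreeMagma X) : IsHall t → [a] < word t → IsHall (.of a * t)
  | mul_mul (r s t : FreeMagma X) : IsHall (r * s) → IsHall t → word (r * s) < word t →
      word t ≤ word s → IsHall (r * s * t)

theorem IsHall.of_mul_cases {s t : FreeMagma X} (h : IsHall (s * t)) :
    IsHall s ∧ IsHall t ∧ word s < word t := by
  cases h with
  | of_mul a t ht h => exact ⟨.of a, ht, h⟩
  | mul_mul r s t hs ht h _ => exact ⟨hs, ht, h⟩

theorem isLyndon_singleton (a : X) : IsLyndon [a] := by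
  refine ⟨by simp, fun u v hu hv huv => ?_⟩
  have := congrArg List.length huv
  have := List.length_pos_of_ne_nil hu
  have := List.length_pos_of_ne_nil hv
  simp only [List.length_append, List.length_singleton] at *
  omega

theorem IsHall.isLyndon {t : FreeMagma X} (h : IsHall t) : IsLyndon (word t) := by
  induction t with
  | ih1 a => exact isLyndon_singleton a
  | ih2 s t hs ht =>
    obtain ⟨h1, h2, h3⟩ := h.of_mul_cases
    exact (hs h1).append (ht h2) h3

/-- The right factor of a Hall tree is its smallest proper suffix. -/
theorem IsHall.word_right_le {s t : FreeMagma X} (h : IsHall (s * t)) {a b : List X}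
    (ha : a ≠ []) (hb : b ≠ []) (hab : word (s * t) = a ++ b) : word t ≤ b := by
  induction s generalizing t a b with
  | ih1 x =>
    obtain ⟨-, ht, -⟩ := h.of_mul_cases
    cases a with
    | nil => exact absurd rfl ha
    | cons y a =>
      simp only [word_mul, word_of, List.cons_append, List.nil_append, List.cons.injEq] at hab
      rcases eq_or_ne a [] with rfl | ha0
      · simp [hab.2]
      · exact (ht.isLyndon.2 a b ha0 hb hab.2).le
  | ih2 r s ihr _ =>
    obtain ⟨hrs, ht, -⟩ := h.of_mul_cases
    have hle : word t ≤ word s := by cases h; assumption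
    rw [word_mul] at hab
    rcases List.append_eq_append_iff.mp hab with ⟨c, hc', hc⟩ | ⟨c, hc, rfl⟩
    · rcases eq_or_ne c [] with rfl | hc0
      · exact (show b = word t by simpa using hc.symm).ge
      · exact (ht.isLyndon.2 c b hc0 hb hc).le
    · rcases eq_or_ne c [] with rfl | hc0
      · simp
      · exact (hle.trans (ihr hrs ha hc0 hc)).trans (lt_append_self (word_ne_nil t)).le

/-- The word determines the root splitting, since the right factor is the smallest proper nonempty
suffix; induction recovers the tree. -/
theorem IsHall.eq_of_word_eq {s t : FreeMagma X} (hs : IsHall s) (ht : IsHall t)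
    (h : word s = word t) : s = t := by
  have len : ∀ (a : X) (u v : FreeMagma X), [a] ≠ word u ++ word v := by
    intro a u v h
    have := congrArg List.length h
    have := List.length_pos_of_ne_nil (word_ne_nil u)
    have := List.length_pos_of_ne_nil (word_ne_nil v)
    simp only [List.length_append, List.length_singleton] at *
    omega
  induction s generalizing t with
  | ih1 a =>
    induction t with
    | ih1 b => rw [show a = b by simpa using h]
    | ih2 u v => exact absurd h (len a u v)
  | ih2 p q ihp ihq =>
    induction t with
    | ih1 b => exact absurd h.symm (len b p q)
    | ih2 u v =>
      have hqv : word q = word v := le_antisymm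
        (hs.word_right_le (word_ne_nil u) (word_ne_nil v) h)
        (ht.word_right_le (word_ne_nil p) (word_ne_nil q) h.symm)
      have hpu : word p = word u := by
        rw [word_mul, word_mul, hqv] at h
        exact List.append_cancel_right h
      rw [ihp hs.of_mul_cases.1 ht.of_mul_cases.1 hpu,
        ihq hs.of_mul_cases.2.1 ht.of_mul_cases.2.1 hqv]

end HallTrees

/-! ### Straightening brackets into Hall trees -/

section HallSpan

variable {X F L : Type*} [CommRing F] [LieRing L] [LieAlgebra F L]

/-- Evaluation of a tree as an iterated bracket. -/
def evalTree (x : X → L) : FreeMagma X → L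
  | .of a => x a
  | .mul s t => ⁅evalTree x s, evalTree x t⁆

@[simp]
theorem evalTree_of (x : X → L) (a : X) : evalTree x (.of a) = x a := rfl

@[simp]
theorem evalTree_mul (x : X → L) (s t : FreeMagma X) :
    evalTree x (s * t) = ⁅evalTree x s, evalTree x t⁆ := rfl

/-- A bilinear bracket of elements of two spans lies in any submodule containing the brackets of
the generators. -/
theorem lie_mem_of_mem_span {S T : Set L} {N : Submodule F L}
    (h : ∀ a ∈ S, ∀ b ∈ T, ⁅a, b⁆ ∈ N) {a b : L} (ha : a ∈ Submodule.span F S)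
    (hb : b ∈ Submodule.span F T) : ⁅a, b⁆ ∈ N := by
  induction ha using Submodule.span_induction with
  | mem a ha =>
    induction hb using Submodule.span_induction with
    | mem b hb => exact h a ha b hb
    | zero => simp
    | add _ _ _ _ h1 h2 => rw [lie_add]; exact N.add_mem h1 h2
    | smul c _ _ h1 => rw [lie_smul]; exact N.smul_mem c h1
  | zero => simp
  | add _ _ _ _ h1 h2 => rw [add_lie]; exact N.add_mem h1 h2
  | smul c _ _ h1 => rw [smul_lie]; exact N.smul_mem c h1

variable [LinearOrder X] [Finite X]

/-- Double induction: on the degree n, then on the larger word M. The bound `word r < M` on the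
resulting trees is what lets the inner induction continue after a use of the Jacobi identity. -/
theorem lie_evalTree_mem (x : X → L) (n : ℕ) :
    ∀ (M s t : _), IsHall s → IsHall t → (word s).length + (word t).length = n →
      word s < word t → word t = M →
      ⁅evalTree x s, evalTree x t⁆ ∈ Submodule.span F (evalTree x ''
        {r : FreeMagma X | IsHall r ∧ (word r).length = n ∧ word r < M}) := by
  induction n using Nat.strong_induction_on with
  | _ n ihn =>
  have hfin : {w : List X | w.length ≤ n}.Finite := List.finite_length_le X n
  -- Lexicographic order is not well-founded on all words (b > ab > aab > ...), but it is on the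
  -- finitely many words of bounded length.
  have hwf := hfin.wellFoundedOn (r := (· < ·))
  intro M
  by_cases hM : M.length ≤ n
  swap
  · rintro s t - - hl - rfl
    omega
  refine hwf.induction (P := fun M => ∀ s t, IsHall s → IsHall t →
    (word s).length + (word t).length = n → word s < word t → word t = M →
      ⁅evalTree x s, evalTree x t⁆ ∈ Submodule.span F (evalTree x ''
        {r : FreeMagma X | IsHall r ∧ (word r).length = n ∧ word r < M})) hM ?_
  rintro M hM ihM s t hs ht hl hst rfl
  have hpos := List.length_pos_of_ne_nil (word_ne_nil t)
  have key : ∀ u v, IsHall u → IsHall v → (word u).length + (word v).length = n →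
      word u < word t → word v < word t →
      ⁅evalTree x u, evalTree x v⁆ ∈ Submodule.span F (evalTree x ''
        {r : FreeMagma X | IsHall r ∧ (word r).length = n ∧ word r < word t}) := by
    intro u v hu hv huv hut hvt
    rcases lt_trichotomy (word u) (word v) with h | h | h
    · refine Submodule.span_mono (Set.image_mono fun r hr => ?_)
        (ihM (word v) (by simp; omega) hvt u v hu hv huv h rfl)
      exact ⟨hr.1, hr.2.1, hr.2.2.trans hvt⟩
    · rw [hu.eq_of_word_eq hv h, lie_self]
      exact zero_mem _
    · rw [← lie_skew]
      refine neg_mem (Submodule.span_mono (Set.image_mono fun r hr => ?_)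
        (ihM (word u) (by simp; omega) hut v u hv hu (by omega) h rfl))
      exact ⟨hr.1, hr.2.1, hr.2.2.trans hut⟩
  have std : IsHall (s * t) → ⁅evalTree x s, evalTree x t⁆ ∈ Submodule.span F (evalTree x ''
        {r : FreeMagma X | IsHall r ∧ (word r).length = n ∧ word r < word t}) := fun h =>
    Submodule.subset_span ⟨s * t, ⟨h, by simpa using hl,
      hs.isLyndon.append_lt_right ht.isLyndon hst⟩, rfl⟩
  induction s with
  | ih1 a => exact std (.of_mul a t ht hst)
  | ih2 p q =>
    rcases le_or_gt (word t) (word q) with hle | hlt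
    · exact std (.mul_mul p q t hs ht hst hle)
    · obtain ⟨hp, hq, hpq⟩ := hs.of_mul_cases
      have hp0 := List.length_pos_of_ne_nil (word_ne_nil p)
      have hq0 := List.length_pos_of_ne_nil (word_ne_nil q)
      rw [word_mul, List.length_append] at hl
      -- When s = pq with q < t, Jacobi gives [p,[q,t]] - [q,[p,t]]. The inner brackets have smaller
      -- degree and expand into trees below t; the outer brackets then involve only words below t.
      rw [evalTree_mul, lie_lie]
      refine sub_mem ?_ ?_
      · have h1 := ihn _ (by omega) (word t) q t hq ht rfl hlt rfl
        refine lie_mem_of_mem_span (S := {evalTree x p}) ?_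
          (Submodule.mem_span_singleton_self _) h1
        rintro _ rfl _ ⟨r, ⟨hr, hrl, hrt⟩, rfl⟩
        exact key p r hp hr (by omega) (hpq.trans hlt) hrt
      · have h1 := ihn _ (by omega) (word t) p t hp ht rfl (hpq.trans hlt) rfl
        refine lie_mem_of_mem_span (S := {evalTree x q}) ?_
          (Submodule.mem_span_singleton_self _) h1
        rintro _ rfl _ ⟨r, ⟨hr, hrl, hrt⟩, rfl⟩
        exact key q r hq hr (by omega) hlt hrt

/-- The Lie subalgebra generated by the `x a` is spanned by the evaluations of the Hall trees. -/
theorem lieSpan_range_le_span_evalTree (x : X → L) :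
    (LieSubalgebra.lieSpan F L (Set.range x)).toSubmodule ≤
      Submodule.span F (evalTree x '' {t | IsHall t}) := by
  let K : LieSubalgebra F L :=
    { Submodule.span F (evalTree x '' {t | IsHall t}) with
      lie_mem' := by
        intro a b ha hb
        refine lie_mem_of_mem_span ?_ ha hb
        rintro _ ⟨s, hs, rfl⟩ _ ⟨t, ht, rfl⟩
        rcases lt_trichotomy (word s) (word t) with h | h | h
        · exact Submodule.span_mono (Set.image_mono fun r hr => hr.1)
            (lie_evalTree_mem x _ _ s t hs ht rfl h rfl)
        · rw [IsHall.eq_of_word_eq hs ht h, lie_self]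
          exact zero_mem _
        · rw [← lie_skew]
          exact neg_mem (Submodule.span_mono (Set.image_mono fun r hr => hr.1)
            (lie_evalTree_mem x _ _ t s ht hs rfl h rfl)) }
  have : LieSubalgebra.lieSpan F L (Set.range x) ≤ K := by
    rw [LieSubalgebra.lieSpan_le]
    rintro _ ⟨a, rfl⟩
    exact Submodule.subset_span ⟨.of a, .of a, rfl⟩
  exact this

end HallSpan

/-! ### Leading words of Lie polynomials -/

section LeadingWords

variable {X F : Type*} [CommRing F]

/-- The noncommutative polynomials that are homogeneous of degree `d`. -/
def homogeneous (F X : Type*) [CommRing F] (d : ℕ) :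
    Submodule F (MonoidAlgebra F (FreeMonoid X)) where
  carrier := {f | ∀ w : List X, w.length ≠ d → f.coeff (FreeMonoid.ofList w) = 0}
  zero_mem' := fun w _ => by simp
  add_mem' := fun {f g} hf hg w hw => by simp [hf w hw, hg w hw]
  smul_mem' := fun c f hf w hw => by simp [hf w hw]

/-- Homogeneity of f fixes the length of the left factor, so a single factorization of the word
contributes. -/
theorem coeff_mul_append {f : MonoidAlgebra F (FreeMonoid X)} (g : MonoidAlgebra F (FreeMonoid X))
    {u : List X} (hf : f ∈ homogeneous F X u.length) (v : List X) :
    (f * g).coeff (FreeMonoid.ofList (u ++ v)) =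
      f.coeff (FreeMonoid.ofList u) * g.coeff (FreeMonoid.ofList v) := by
  classical
  rw [MonoidAlgebra.coeff_mul, Finsupp.sum_eq_single (FreeMonoid.ofList u),
    Finsupp.sum_eq_single (FreeMonoid.ofList v)]
  · rw [if_pos (by rw [FreeMonoid.ofList_append])]
  · intro w _ hwv
    refine if_neg fun h => hwv ?_
    rw [FreeMonoid.ofList_append] at h
    exact mul_left_cancel h
  · simp
  · intro w hw hwu
    refine Finset.sum_eq_zero fun w' _ => if_neg fun h => ?_
    have hl : w.toList.length = u.length := by
      by_contra hl
      exact hw (by simpa using hf w.toList hl)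
    have h' : w.toList ++ w'.toList = u ++ v := by
      rw [← FreeMonoid.toList_mul, h, FreeMonoid.toList_ofList]
    exact hwu (by rw [← (List.append_inj h' hl).1, FreeMonoid.ofList_toList])
  · simp

theorem mul_mem_homogeneous {d e : ℕ} {f g : MonoidAlgebra F (FreeMonoid X)}
    (hf : f ∈ homogeneous F X d) (hg : g ∈ homogeneous F X e) : f * g ∈ homogeneous F X (d + e) := by
  classical
  intro w hw
  rw [MonoidAlgebra.coeff_mul]
  refine Finset.sum_eq_zero fun u hu => Finset.sum_eq_zero fun v hv => if_neg fun h => hw ?_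
  have hu' : u.toList.length = d := by
    by_contra hl
    exact Finsupp.mem_support_iff.mp hu (by simpa using hf u.toList hl)
  have hv' : v.toList.length = e := by
    by_contra hl
    exact Finsupp.mem_support_iff.mp hv (by simpa using hg v.toList hl)
  rw [← hu', ← hv', ← List.length_append, ← FreeMonoid.toList_mul, h, FreeMonoid.toList_ofList]

theorem one_mem_homogeneous : (1 : MonoidAlgebra F (FreeMonoid X)) ∈ homogeneous F X 0 := by
  classical
  intro w hw
  rw [MonoidAlgebra.one_def, MonoidAlgebra.coeff_single, Finsupp.single_apply, if_neg]
  rintro h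
  rw [← FreeMonoid.toList_ofList w, ← h] at hw
  exact hw rfl

/-- The letter `a`, as a noncommutative polynomial. -/
noncomputable def letter (F : Type*) [CommRing F] (a : X) : MonoidAlgebra F (FreeMonoid X) :=
  MonoidAlgebra.single (FreeMonoid.of a) 1

theorem coeff_letter_of_ne {a : X} {w : List X} (h : w ≠ [a]) :
    (letter F a).coeff (FreeMonoid.ofList w) = 0 := by
  classical
  rw [letter, MonoidAlgebra.coeff_single, Finsupp.single_apply, if_neg]
  intro e
  exact h (by rw [← FreeMonoid.toList_ofList w, ← e, FreeMonoid.toList_of])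

theorem letter_mem_homogeneous (a : X) : letter F a ∈ homogeneous F X 1 :=
  fun _ hw => coeff_letter_of_ne fun h => hw (by simp [h])

theorem evalTree_letter_mem_homogeneous (t : FreeMagma X) :
    evalTree (letter F) t ∈ homogeneous F X (word t).length := by
  induction t with
  | ih1 a => exact letter_mem_homogeneous a
  | ih2 s t hs ht =>
    rw [evalTree_mul, word_mul, List.length_append, LieRing.of_associative_ring_bracket]
    refine sub_mem (mul_mem_homogeneous hs ht) ?_
    rw [add_comm]
    exact mul_mem_homogeneous ht hs

variable [LinearOrder X]

/-- `f = c w + (larger words)`, where only words of the length of `w` are considered. -/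
def HasLead (w : List X) (c : F) (f : MonoidAlgebra F (FreeMonoid X)) : Prop :=
  f.coeff (FreeMonoid.ofList w) = c ∧
    ∀ u : List X, u.length = w.length → u < w → f.coeff (FreeMonoid.ofList u) = 0

theorem HasLead.add {w : List X} {a b : F} {f g : MonoidAlgebra F (FreeMonoid X)}
    (hf : HasLead w a f) (hg : HasLead w b g) : HasLead w (a + b) (f + g) :=
  ⟨by simp [hf.1, hg.1], fun u hu huw => by simp [hf.2 u hu huw, hg.2 u hu huw]⟩

theorem HasLead.smul {w : List X} {a : F} {f : MonoidAlgebra F (FreeMonoid X)} (c : F)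
    (hf : HasLead w a f) : HasLead w (c * a) (c • f) :=
  ⟨by simp [hf.1], fun u hu huw => by simp [hf.2 u hu huw]⟩

theorem HasLead.zero (w : List X) : HasLead w (0 : F) 0 := by
  simp [HasLead]

theorem HasLead.sum {ι : Type*} {w : List X} (s : Finset ι) {c : ι → F}
    {f : ι → MonoidAlgebra F (FreeMonoid X)} (h : ∀ i ∈ s, HasLead w (c i) (f i)) :
    HasLead w (∑ i ∈ s, c i) (∑ i ∈ s, f i) := by
  classical
  induction s using Finset.induction_on with
  | empty => simpa using HasLead.zero w
  | insert i s hi ih =>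
    rw [Finset.sum_insert hi, Finset.sum_insert hi]
    exact (h i (by simp)).add (ih fun j hj => h j (by simp [hj]))

theorem HasLead.mul {u v : List X} {a b : F} {f g : MonoidAlgebra F (FreeMonoid X)}
    (hf : HasLead u a f) (hg : HasLead v b g) (hfu : f ∈ homogeneous F X u.length) :
    HasLead (u ++ v) (a * b) (f * g) := by
  refine ⟨by rw [coeff_mul_append g hfu, hf.1, hg.1], fun w hw hlt => ?_⟩
  rw [List.length_append] at hw
  have hl : (w.take u.length).length = u.length := by simp; omega
  have hl' : (w.drop u.length).length = v.length := by simp; omega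
  rw [← List.take_append_drop u.length w] at hlt ⊢
  rw [coeff_mul_append g (by rwa [hl])]
  rcases lt_trichotomy (w.take u.length) u with h | h | h
  · rw [hf.2 _ hl h, zero_mul]
  · rw [h, append_left_lt_iff] at hlt
    rw [hg.2 _ hl' hlt, mul_zero]
  · exact absurd hlt (append_lt_append_of_length_le h hl.le _ _).not_gt

/-- The coefficient in `HasLead` may be zero, so terms that start later can be added without case
distinctions. -/
theorem HasLead.of_lt {u v : List X} {a : F} {f : MonoidAlgebra F (FreeMonoid X)}
    (hf : HasLead v a f) (hl : u.length = v.length) (h : u < v) : HasLead u 0 f :=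
  ⟨hf.2 u hl h, fun w hw hwu => hf.2 w (hw.trans hl) (hwu.trans h)⟩

theorem HasLead.pow {u : List X} {a : F} {f : MonoidAlgebra F (FreeMonoid X)}
    (hf : HasLead u a f) (hfu : f ∈ homogeneous F X u.length) (n : ℕ) :
    HasLead (List.replicate n u).flatten (a ^ n) (f ^ n) := by
  induction n with
  | zero =>
    refine ⟨by simp [MonoidAlgebra.one_def], fun w hw hlt => ?_⟩
    simp at hlt
  | succ n ih =>
    rw [List.replicate_succ, List.flatten_cons, pow_succ', pow_succ']
    exact hf.mul ih hfu

/-- A Hall polynomial has its Lyndon word as leading word, with coefficient one. -/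
theorem IsHall.hasLead {t : FreeMagma X} (h : IsHall t) :
    HasLead (word t) 1 (evalTree (letter F) t) := by
  induction t with
  | ih1 a =>
    refine ⟨?_, fun u _ hlt => coeff_letter_of_ne hlt.ne⟩
    rw [evalTree_of, letter, MonoidAlgebra.coeff_single]
    exact Finsupp.single_eq_same
  | ih2 s t ihs iht =>
    obtain ⟨hs, ht, hst⟩ := h.of_mul_cases
    have h1 := (ihs hs).mul (iht ht) (evalTree_letter_mem_homogeneous s)
    have h2 := (iht ht).mul (ihs hs) (evalTree_letter_mem_homogeneous t)
    -- The reversed product ts starts at a larger word, so it does not disturb the leading term of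
    -- st.
    have hlt : word s ++ word t < word t ++ word s :=
      (hs.isLyndon.append_lt_right ht.isLyndon hst).trans (lt_append_self (word_ne_nil s))
    have h3 := h1.add ((h2.of_lt (by simp [add_comm]) hlt).smul (-1))
    rw [evalTree_mul, LieRing.of_associative_ring_bracket, sub_eq_add_neg,
      ← neg_one_smul F (_ * _)]
    simpa using h3

/-- The leading words of the elements of the free Lie algebra are Lyndon words. -/
theorem isLyndon_of_hasLead [Finite X] {P : MonoidAlgebra F (FreeMonoid X)}
    (hP : P ∈ LieSubalgebra.lieSpan F (MonoidAlgebra F (FreeMonoid X)) (Set.range (letter F)))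
    {w : List X} {c : F} (hw : HasLead w c P) (hc : c ≠ 0) : IsLyndon w := by
  have hP' := lieSpan_range_le_span_evalTree (F := F) (letter F) hP
  obtain ⟨a, ha, rfl⟩ := (Finsupp.mem_span_image_iff_linearCombination F).mp hP'
  rw [Finsupp.mem_supported] at ha
  -- the Hall trees of the right degree which occur with nonzero coefficient
  let S := {t ∈ a.support | (word t).length = w.length}
  have hsum : ∀ u : List X, u.length = w.length →
      (Finsupp.linearCombination F (evalTree (letter F)) a).coeff (FreeMonoid.ofList u) =
        ∑ t ∈ S, a t * (evalTree (letter F) t).coeff (FreeMonoid.ofList u) := by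
    intro u hu
    rw [Finsupp.linearCombination_apply, Finsupp.sum, MonoidAlgebra.coeff_sum,
      Finsupp.finsetSum_apply, Finset.sum_filter]
    refine Finset.sum_congr rfl fun t _ => ?_
    rw [MonoidAlgebra.coeff_smul, Finsupp.smul_apply, smul_eq_mul]
    split_ifs with h
    · rfl
    · rw [evalTree_letter_mem_homogeneous t u (fun h' => h (h'.symm.trans hu)), mul_zero]
  have hS : S.Nonempty := by
    by_contra hS
    rw [Finset.not_nonempty_iff_eq_empty] at hS
    exact hc (by rw [← hw.1, hsum w rfl, hS, Finset.sum_empty])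
  -- Distinct Hall trees have distinct words, so the coefficient at the smallest Hall word cannot
  -- cancel; this word must therefore be w.
  obtain ⟨t, htS, hmin⟩ := S.exists_min_image word hS
  have hH : ∀ s ∈ S, IsHall s := fun s hs => ha (Finset.mem_filter.mp hs).1
  have hl : ∀ s ∈ S, (word s).length = w.length := fun s hs => (Finset.mem_filter.mp hs).2
  have hzero : ∀ s ∈ S, ∀ u : List X, u.length = w.length → u < word s →
      (evalTree (letter F) s).coeff (FreeMonoid.ofList u) = 0 := fun s hs u hu hlt =>
    (hH s hs).hasLead.2 u (hu.trans (hl s hs).symm) hlt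
  have hle : word t ≤ w := by
    by_contra hlt
    refine hc ?_
    rw [← hw.1, hsum w rfl]
    exact Finset.sum_eq_zero fun s hs => by
      rw [hzero s hs w rfl ((not_le.mp hlt).trans_le (hmin s hs)), mul_zero]
  have hcoeff : (Finsupp.linearCombination F (evalTree (letter F)) a).coeff
      (FreeMonoid.ofList (word t)) = a t := by
    rw [hsum _ (hl t htS), Finset.sum_eq_single_of_mem t htS, (hH t htS).hasLead.1, mul_one]
    intro s hs hst
    rw [hzero s hs _ (hl t htS), mul_zero]
    exact lt_of_le_of_ne (hmin s hs) fun h => hst ((hH t htS).eq_of_word_eq (hH s hs) h).symm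
  rcases hle.eq_or_lt with h | h
  · rw [← h]
    exact (hH t htS).isLyndon
  · rw [hw.2 _ (hl t htS) h] at hcoeff
    exact absurd hcoeff.symm (Finsupp.mem_support_iff.mp (Finset.mem_filter.mp htS).1)

end LeadingWords

/-! ### Jacobson's formula for p-th powers of sums -/

section Jacobson

/-- By Pascal's rule, neighbouring binomial coefficients in row p - 1 sum to one in row p, which
vanishes in E. -/
theorem choose_pred_mul_neg_one_pow {E : Type*} [Ring E] {p : ℕ} (hp : p.Prime)
    (hE : (p : E) = 0) {m : ℕ} (hm : m < p) : ((p - 1).choose m : E) * (-1 : E) ^ m = 1 := by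
  induction m with
  | zero => simp
  | succ m ih =>
    have h : (((p - 1).choose m + (p - 1).choose (m + 1) : ℕ) : E) = 0 := by
      rw [← Nat.choose_succ_succ', Nat.sub_add_cancel hp.one_le]
      obtain ⟨c, hc⟩ := hp.dvd_choose_self (Nat.succ_ne_zero m) hm
      rw [hc, Nat.cast_mul, hE, zero_mul]
    rw [Nat.cast_add] at h
    rw [pow_succ, mul_neg_one, eq_neg_of_add_eq_zero_right h, neg_mul_neg]
    exact ih (by omega)

/-- Intended for x and y the left and right multiplications by one element, so that x - y is its
adjoint map. -/
theorem sub_pow_pred_char_of_commute {E : Type*} [Ring E] {p : ℕ} (hp : p.Prime)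
    (hE : (p : E) = 0) {x y : E} (h : Commute x y) :
    (x - y) ^ (p - 1) = ∑ i ∈ Finset.range p, x ^ i * y ^ (p - 1 - i) := by
  rw [sub_eq_neg_add, (h.symm.neg_left).add_pow, Nat.sub_add_cancel hp.one_le, h.geom_sum₂_comm]
  refine Finset.sum_congr rfl fun i hi => ?_
  rw [neg_pow, ← (Nat.cast_commute _ _).eq, mul_assoc ((-1) ^ i), ← mul_assoc,
    choose_pred_mul_neg_one_pow hp hE (Finset.mem_range.mp hi), one_mul]

variable {F A : Type*} [Field F] [Ring A] [Algebra F A]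

theorem natCast_end_eq_zero {p : ℕ} (hA : (p : A) = 0) : (p : Module.End ℤ A) = 0 := by
  ext z
  rw [Module.End.natCast_apply, nsmul_eq_mul, hA, zero_mul, LinearMap.zero_apply]

/-- In characteristic `p`, the `(p-1)`-st power of `ad y` is a sum of products of left and right
multiplications. -/
theorem iterate_lie_pred_char {p : ℕ} (hp : p.Prime) (hA : (p : A) = 0) (y a : A) :
    (fun z => ⁅y, z⁆)^[p - 1] a = ∑ i ∈ Finset.range p, y ^ i * a * y ^ (p - 1 - i) := by
  have h := congrArg (fun f : Module.End ℤ A => f a)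
    (sub_pow_pred_char_of_commute hp (natCast_end_eq_zero hA)
      (LinearMap.commute_mulLeft_right (R := ℤ) y y))
  simp only [LinearMap.pow_mulLeft, LinearMap.pow_mulRight, LinearMap.sum_apply,
    Module.End.mul_apply, LinearMap.mulLeft_apply, LinearMap.mulRight_apply,
    Module.End.pow_apply] at h
  simp only [← mul_assoc] at h
  exact h

/-- In characteristic `p`, the `p`-th power of `ad y` is `ad (y ^ p)`. -/
theorem iterate_lie_char {p : ℕ} (hp : p.Prime) (hA : (p : A) = 0) (y a : A) :
    (fun z => ⁅y, z⁆)^[p] a = ⁅y ^ p, a⁆ := by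
  have hc := LinearMap.commute_mulLeft_right (R := ℤ) y y
  have h1 := sub_pow_pred_char_of_commute hp (natCast_end_eq_zero hA) hc
  have h2 := hc.mul_geom_sum₂ p
  rw [← h1, ← pow_succ', Nat.sub_add_cancel hp.one_le, LinearMap.pow_mulLeft,
    LinearMap.pow_mulRight] at h2
  have h := congrArg (fun f : Module.End ℤ A => f a) h2
  simp only [Module.End.pow_apply] at h
  exact h

open Polynomial in
theorem derivative_pow_eq_sum (y : A[X]) (n : ℕ) :
    derivative (y ^ n) = ∑ i ∈ Finset.range n, y ^ i * derivative y * y ^ (n - 1 - i) := by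
  induction n with
  | zero => simp
  | succ n ih =>
    rw [pow_succ, derivative_mul, ih, Finset.sum_range_succ, Finset.sum_mul]
    congr 1
    · refine Finset.sum_congr rfl fun i hi => ?_
      have := Finset.mem_range.mp hi
      rw [mul_assoc _ _ y, ← pow_succ]
      congr 2
      omega
    · simp

open Polynomial in
/-- Jacobson's formula: in characteristic `p`, the `p`-th power is additive modulo any submodule
that contains `⁅b, a⁆` and is stable under `ad a` and `ad b`. -/
theorem add_pow_sub_mem {p : ℕ} [hp : Fact p.Prime] [CharP F p] {N : Submodule F A} {a b : A}
    (hab : ⁅b, a⁆ ∈ N) (ha : ∀ z ∈ N, ⁅a, z⁆ ∈ N) (hb : ∀ z ∈ N, ⁅b, z⁆ ∈ N) :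
    (a + b) ^ p - a ^ p - b ^ p ∈ N := by
  have hA : (p : A) = 0 := by
    rw [← map_natCast (algebraMap F A), CharP.cast_eq_zero, map_zero]
  have hAX : (p : A[X]) = 0 := by rw [← C_eq_natCast, hA, C_0]
  -- The p-th power of aX + b has constant term b^p, top coefficient a^p and value (a + b)^p at X =
  -- 1. Its middle coefficients are read off from the derivative, which is (ad y)^(p-1) applied to
  -- a.
  set y : A[X] := C a * X + C b with hy
  have hdy : derivative y = C a := by simp [hy]
  have hlie : ∀ f : A[X], ⁅y, f⁆ = (C a * f - f * C a) * X + (C b * f - f * C b) := by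
    intro f
    rw [LieRing.of_associative_ring_bracket, hy, add_mul, mul_add, sub_mul, mul_assoc (C a), X_mul,
      ← mul_assoc, ← mul_assoc]
    abel
  have hcoeff : ∀ (f : A[X]) (n : ℕ), ⁅y, f⁆.coeff (n + 1) =
      ⁅a, f.coeff n⁆ + ⁅b, f.coeff (n + 1)⁆ := by
    intro f n
    rw [hlie, coeff_add, coeff_mul_X]
    simp [LieRing.of_associative_ring_bracket]
  have hcoeff0 : ∀ f : A[X], ⁅y, f⁆.coeff 0 = ⁅b, f.coeff 0⁆ := by
    intro f
    rw [hlie, coeff_add, coeff_mul_X_zero]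
    simp [LieRing.of_associative_ring_bracket]
  -- At least one bracket is required, as a itself need not lie in N; this suffices because p - 1 is
  -- positive.
  have hiter : ∀ n i, ((fun z => ⁅y, z⁆)^[n + 1] (C a)).coeff i ∈ N := by
    intro n
    induction n with
    | zero =>
      rintro (_ | _ | i)
      · rw [zero_add, Function.iterate_one, hcoeff0, coeff_C_zero]
        exact hab
      · rw [zero_add, Function.iterate_one, hcoeff]
        simp
      · rw [zero_add, Function.iterate_one, hcoeff]
        simp
    | succ n ih =>
      intro i
      rw [Function.iterate_succ_apply']
      cases i with
      | zero => rw [hcoeff0]; exact hb _ (ih 0)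
      | succ i => rw [hcoeff]; exact add_mem (ha _ (ih i)) (hb _ (ih (i + 1)))
  have hder : derivative (y ^ p) = (fun z => ⁅y, z⁆)^[p - 1] (C a) := by
    rw [derivative_pow_eq_sum, hdy, iterate_lie_pred_char hp.out hAX]
  have hmem : ∀ i, i + 1 < p → (y ^ p).coeff (i + 1) ∈ N := by
    intro i hi
    have h1 : (derivative (y ^ p)).coeff i ∈ N := by
      obtain ⟨n, hn⟩ : ∃ n, p - 1 = n + 1 := ⟨p - 2, by have := hp.out.two_le; omega⟩
      rw [hder, hn]
      exact hiter n i
    have h2 : ((i + 1 : ℕ) : F) ≠ 0 := by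
      rw [Ne, CharP.cast_eq_zero_iff F p]
      exact fun h => absurd (Nat.le_of_dvd (Nat.succ_pos i) h) (by omega)
    rw [coeff_derivative] at h1
    have h3 : (y ^ p).coeff (i + 1) * ((i : A) + 1) = ((i + 1 : ℕ) : F) • (y ^ p).coeff (i + 1) := by
      rw [← Nat.cast_succ, ← (Nat.cast_commute _ _).eq, Algebra.smul_def, map_natCast]
    rw [h3] at h1
    exact (N.smul_mem_iff h2).mp h1
  have hdeg : y.natDegree ≤ 1 := natDegree_linear_le
  have hdegp : (y ^ p).natDegree < p + 1 := by
    have := natDegree_pow_le_of_le p hdeg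
    omega
  have hev : (y ^ p).eval 1 = (a + b) ^ p := by
    have := map_pow (eval₂RingHom' (RingHom.id A) 1 fun z => Commute.one_right z) y p
    have h1 : ∀ q : A[X], eval₂RingHom' (RingHom.id A) 1 (fun z => Commute.one_right z) q =
      q.eval 1 := fun q => rfl
    rw [h1, h1] at this
    rw [this]
    simp [hy]
  rw [eval_eq_sum_range' hdegp, Finset.sum_range_succ] at hev
  obtain ⟨q, rfl⟩ : ∃ q, p = q + 1 := ⟨p - 1, by have := hp.out.one_le; omega⟩
  rw [Finset.sum_range_succ'] at hev
  have htop : (y ^ (q + 1)).coeff (q + 1) = a ^ (q + 1) := by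
    have := coeff_pow_of_natDegree_le (m := q + 1) hdeg
    rw [mul_one] at this
    rw [this]
    simp [hy]
  have hbot : (y ^ (q + 1)).coeff 0 = b ^ (q + 1) := by
    have h0 := map_pow (constantCoeff (R := A)) y (q + 1)
    rw [constantCoeff_apply, constantCoeff_apply] at h0
    rw [h0]
    simp [hy]
  rw [htop, hbot] at hev
  rw [← hev]
  simp only [one_pow, mul_one]
  rw [add_sub_cancel_right, add_sub_cancel_right]
  exact sum_mem fun i hi => hmem i (by have := Finset.mem_range.mp hi; omega)

end Jacobson

/-! ### Brackets and p-th powers modulo the Lie subalgebra -/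

section RestrictedLieSpan

variable {F A : Type*} [Field F] [Ring A] [Algebra F A] {p : ℕ} {S : Set A}

theorem subset_restrictedLieSpan : S ⊆ restrictedLieSpan F p S :=
  fun _ hx => mem_restrictedLieSpan.mpr fun _ hK _ => hK hx

theorem pow_mem_restrictedLieSpan {x : A} (hx : x ∈ restrictedLieSpan F p S) :
    x ^ p ∈ restrictedLieSpan F p S :=
  mem_restrictedLieSpan.mpr fun K hK hp => hp _ (mem_restrictedLieSpan.mp hx K hK hp)

theorem restrictedLieSpan_le {K : LieSubalgebra F A} (hS : S ⊆ K) (hp : ∀ x ∈ K, x ^ p ∈ K) :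
    restrictedLieSpan F p S ≤ K :=
  fun _ hx => mem_restrictedLieSpan.mp hx K hS hp

theorem lieSpan_le_restrictedLieSpan :
    LieSubalgebra.lieSpan F A S ≤ restrictedLieSpan F p S :=
  LieSubalgebra.lieSpan_le.mpr subset_restrictedLieSpan

theorem iterate_lie_mem {N : Submodule F A} {x : A} (h : ∀ z ∈ N, ⁅x, z⁆ ∈ N) {a : A}
    (ha : ⁅x, a⁆ ∈ N) {n : ℕ} (hn : n ≠ 0) : (fun z => ⁅x, z⁆)^[n] a ∈ N := by
  obtain ⟨n, rfl⟩ := Nat.exists_eq_succ_of_ne_zero hn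
  induction n with
  | zero => exact ha
  | succ n ih =>
    rw [Function.iterate_succ_apply']
    exact h _ (ih n.succ_ne_zero)

variable [hp : Fact p.Prime] [CharP F p]

/-- The normalizer of the Lie subalgebra contains S and is closed under p-th powers, because ad(x^p)
= (ad x)^p. -/
theorem lie_mem_lieSpan_of_mem_right {x z : A} (hx : x ∈ restrictedLieSpan F p S)
    (hz : z ∈ LieSubalgebra.lieSpan F A S) : ⁅x, z⁆ ∈ LieSubalgebra.lieSpan F A S := by
  have hA : (p : A) = 0 := by
    rw [← map_natCast (algebraMap F A), CharP.cast_eq_zero, map_zero]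
  let N := LieSubalgebra.lieSpan F A S
  let K : LieSubalgebra F A :=
    { carrier := {x | ∀ z ∈ N, ⁅x, z⁆ ∈ N}
      zero_mem' := fun z _ => by rw [zero_lie]; exact zero_mem N
      add_mem' := fun hx hy z hz => by rw [add_lie]; exact add_mem (hx z hz) (hy z hz)
      smul_mem' := fun c x hx z hz => by rw [smul_lie]; exact N.smul_mem c (hx z hz)
      lie_mem' := fun {x y} hx hy z hz => by
        rw [lie_lie]
        exact sub_mem (hx _ (hy z hz)) (hy _ (hx z hz)) }
  refine restrictedLieSpan_le (K := K) ?_ ?_ hx z hz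
  · exact fun y hy z hz => N.lie_mem (LieSubalgebra.subset_lieSpan hy) hz
  · intro y hy z hz
    rw [← iterate_lie_char hp.out hA]
    exact iterate_lie_mem (N := N.toSubmodule) hy (hy z hz) hp.out.ne_zero

/-- Brackets of elements of the restricted Lie subalgebra generated by `S` lie in the Lie
subalgebra generated by `S`. -/
theorem lie_mem_lieSpan {x y : A} (hx : x ∈ restrictedLieSpan F p S)
    (hy : y ∈ restrictedLieSpan F p S) : ⁅x, y⁆ ∈ LieSubalgebra.lieSpan F A S := by
  have hA : (p : A) = 0 := by
    rw [← map_natCast (algebraMap F A), CharP.cast_eq_zero, map_zero]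
  let N := LieSubalgebra.lieSpan F A S
  let R := restrictedLieSpan F p S
  let K : LieSubalgebra F A :=
    { carrier := {x | x ∈ R ∧ ∀ z ∈ R, ⁅x, z⁆ ∈ N}
      zero_mem' := ⟨zero_mem R, fun z _ => by rw [zero_lie]; exact zero_mem N⟩
      add_mem' := fun hx hy =>
        ⟨add_mem hx.1 hy.1, fun z hz => by
          rw [add_lie]; exact add_mem (hx.2 z hz) (hy.2 z hz)⟩
      smul_mem' := fun c x hx =>
        ⟨R.smul_mem c hx.1, fun z hz => by rw [smul_lie]; exact N.smul_mem c (hx.2 z hz)⟩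
      lie_mem' := fun {x y} hx hy =>
        ⟨R.lie_mem hx.1 hy.1, fun z hz => by
          rw [lie_lie]
          exact sub_mem (hx.2 _ (R.lie_mem hy.1 hz)) (hy.2 _ (R.lie_mem hx.1 hz))⟩ }
  have hRK : R ≤ K := by
    refine restrictedLieSpan_le ?_ ?_
    · refine fun x hx => ⟨subset_restrictedLieSpan hx, fun z hz => ?_⟩
      rw [← lie_skew]
      exact neg_mem (lie_mem_lieSpan_of_mem_right hz (LieSubalgebra.subset_lieSpan hx))
    -- The first of the p brackets with x lands in N by assumption on x, and the remaining ones stay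
    -- there since R normalizes N.
    · refine fun x hx => ⟨pow_mem_restrictedLieSpan hx.1, fun z hz => ?_⟩
      rw [← iterate_lie_char hp.out hA]
      exact iterate_lie_mem (N := N.toSubmodule)
        (fun w hw => lie_mem_lieSpan_of_mem_right hx.1 hw) (hx.2 z hz) hp.out.ne_zero
  exact (hRK hx).2 y hy

theorem add_pow_sub_mem_lieSpan {x y : A} (hx : x ∈ restrictedLieSpan F p S)
    (hy : y ∈ restrictedLieSpan F p S) :
    (x + y) ^ p - x ^ p - y ^ p ∈ LieSubalgebra.lieSpan F A S :=
  add_pow_sub_mem (N := (LieSubalgebra.lieSpan F A S).toSubmodule) (lie_mem_lieSpan hy hx)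
    (fun _ hz => lie_mem_lieSpan_of_mem_right hx hz)
    (fun _ hz => lie_mem_lieSpan_of_mem_right hy hz)

end RestrictedLieSpan

/-! ### Homogeneous components of restricted Lie algebras -/

section Components

variable {F A : Type*} [Field F] [Ring A] [Algebra F A]

/-- The part of degree `n` of the Lie subalgebra generated by `B`. -/
def lieComponent (B : Submodule F A) (n : ℕ) : Submodule F A :=
  (LieSubalgebra.lieSpan F A (B : Set A)).toSubmodule ⊓ B ^ n

/-- The part of degree `n` of the restricted Lie subalgebra generated by `B`. -/
def restrictedComponent (p : ℕ) (B : Submodule F A) (n : ℕ) : Submodule F A :=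
  (restrictedLieSpan F p (B : Set A)).toSubmodule ⊓ B ^ n

variable {p : ℕ} {B : Submodule F A}

theorem lieComponent_le_restrictedComponent (n : ℕ) :
    lieComponent B n ≤ restrictedComponent p B n :=
  inf_le_inf_right _ lieSpan_le_restrictedLieSpan

theorem pow_mem_restrictedComponent {j : ℕ} {x : A} (hx : x ∈ restrictedComponent p B j) :
    x ^ p ∈ restrictedComponent p B (p * j) := by
  refine ⟨pow_mem_restrictedLieSpan hx.1, ?_⟩
  rw [mul_comm, pow_mul]
  exact Submodule.pow_mem_pow _ hx.2 p

theorem lieSpan_le_iSup_lieComponent :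
    (LieSubalgebra.lieSpan F A (B : Set A)).toSubmodule ≤ ⨆ n, lieComponent B n := by
  let K : LieSubalgebra F A :=
    { ⨆ n, lieComponent B n with
      lie_mem' := by
        intro x y hx hy
        change x ∈ ⨆ n, lieComponent B n at hx
        change y ∈ ⨆ n, lieComponent B n at hy
        rw [Submodule.iSup_eq_span] at hx hy
        refine lie_mem_of_mem_span ?_ hx hy
        intro a ha b hb
        obtain ⟨i, hi⟩ := Set.mem_iUnion.mp ha
        obtain ⟨j, hj⟩ := Set.mem_iUnion.mp hb
        refine Submodule.mem_iSup_of_mem (i + j) ⟨LieSubalgebra.lie_mem _ hi.1 hj.1, ?_⟩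
        rw [LieRing.of_associative_ring_bracket]
        refine sub_mem ?_ ?_
        · rw [pow_add]
          exact Submodule.mul_mem_mul hi.2 hj.2
        · rw [add_comm, pow_add]
          exact Submodule.mul_mem_mul hj.2 hi.2 }
  have : LieSubalgebra.lieSpan F A (B : Set A) ≤ K := by
    rw [LieSubalgebra.lieSpan_le]
    intro x hx
    exact Submodule.mem_iSup_of_mem 1 ⟨LieSubalgebra.subset_lieSpan hx, by simpa using hx⟩
  exact this

variable [hp : Fact p.Prime] [CharP F p]

theorem add_pow_sub_mem_lieComponent {j : ℕ} {x y : A} (hx : x ∈ restrictedComponent p B j)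
    (hy : y ∈ restrictedComponent p B j) :
    (x + y) ^ p - x ^ p - y ^ p ∈ lieComponent B (p * j) :=
  ⟨add_pow_sub_mem_lieSpan hx.1 hy.1,
    sub_mem (sub_mem (pow_mem_restrictedComponent (add_mem hx hy)).2
      (pow_mem_restrictedComponent hx).2) (pow_mem_restrictedComponent hy).2⟩

/-- The right side contains the Lie subalgebra, hence all brackets of elements of R; it is closed
under p-th powers because these are additive modulo that subalgebra. -/
theorem restrictedLieSpan_le_iSup :
    (restrictedLieSpan F p (B : Set A)).toSubmodule ≤ ⨆ n, (lieComponent B n ⊔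
      Submodule.span F {y | ∃ j x, p * j = n ∧ x ∈ restrictedComponent p B j ∧ y = x ^ p}) := by
  set R := restrictedLieSpan F p (B : Set A) with hR
  set Q : ℕ → Submodule F A := fun n => lieComponent B n ⊔
    Submodule.span F {y | ∃ j x, p * j = n ∧ x ∈ restrictedComponent p B j ∧ y = x ^ p} with hQ
  have hQR : ∀ n, Q n ≤ restrictedComponent p B n := fun n =>
    sup_le (lieComponent_le_restrictedComponent n) (Submodule.span_le.mpr fun y hy => by
      obtain ⟨j, x, rfl, hx, rfl⟩ := hy
      exact pow_mem_restrictedComponent hx)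
  have hQR' : (⨆ n, Q n) ≤ R.toSubmodule := iSup_le fun n => (hQR n).trans inf_le_left
  have hLQ : (LieSubalgebra.lieSpan F A (B : Set A)).toSubmodule ≤ ⨆ n, Q n :=
    lieSpan_le_iSup_lieComponent.trans (iSup_mono fun n => le_sup_left)
  let K : LieSubalgebra F A :=
    { ⨆ n, Q n with
      lie_mem' := fun {x y} hx hy => hLQ (lie_mem_lieSpan (p := p) (hQR' hx) (hQR' hy)) }
  have : R ≤ K := by
    refine restrictedLieSpan_le (fun x hx => hLQ (LieSubalgebra.subset_lieSpan hx)) ?_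
    intro x hx
    change x ∈ ⨆ n, Q n at hx
    change x ^ p ∈ ⨆ n, Q n
    induction hx using Submodule.iSup_induction' with
    | mem n y hy =>
      exact Submodule.mem_iSup_of_mem (p * n)
        (Submodule.mem_sup_right (Submodule.subset_span ⟨n, y, rfl, hQR n hy, rfl⟩))
    | zero =>
      rw [zero_pow hp.out.ne_zero]
      exact zero_mem _
    | add y z hy hz hy' hz' =>
      have := add_mem (add_mem (hLQ (add_pow_sub_mem_lieSpan (hQR' hy) (hQR' hz))) hy') hz'
      rwa [sub_add_eq_add_sub, sub_add_cancel, sub_add_cancel] at this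
  exact this

/-- Passes from a sum over all degrees to a single degree by uniqueness of homogeneous components.
-/
theorem inf_iSup_eq_of_le {M : Submodule F A} {T Q : ℕ → Submodule F A} (hT : iSupIndep T)
    (hQ : ∀ n, Q n ≤ T n) (n : ℕ) (hM : M ≤ ⨆ n, Q n) : M ⊓ T n ≤ Q n := by
  rintro x ⟨hxM, hxT⟩
  have hx := hM hxM
  have h1 : (⨆ i, Q i) ≤ Q n ⊔ ⨆ (j) (_ : j ≠ n), Q j := iSup_le fun i => by
    rcases eq_or_ne i n with rfl | h
    · exact le_sup_left
    · exact le_sup_of_le_right (le_iSup₂_of_le i h le_rfl)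
  obtain ⟨a, ha, b, hb, rfl⟩ := Submodule.mem_sup.mp (h1 hx)
  have hb' : b ∈ T n := by simpa using sub_mem hxT (hQ n ha)
  have hb'' : b ∈ ⨆ (j) (_ : j ≠ n), T j := iSup₂_mono (fun j _ => hQ j) hb
  rw [(Submodule.disjoint_def.mp (hT n)) b hb' hb'', add_zero]
  exact ha

theorem restrictedComponent_le (hB : iSupIndep fun n => B ^ n) (n : ℕ) :
    restrictedComponent p B n ≤ lieComponent B n ⊔
      Submodule.span F {y | ∃ j x, p * j = n ∧ x ∈ restrictedComponent p B j ∧ y = x ^ p} := by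
  refine inf_iSup_eq_of_le hB (fun n => ?_) n restrictedLieSpan_le_iSup
  refine sup_le inf_le_right (Submodule.span_le.mpr fun y hy => ?_)
  obtain ⟨j, x, rfl, hx, rfl⟩ := hy
  exact (pow_mem_restrictedComponent hx).2

theorem restrictedComponent_eq_lieComponent (hB : iSupIndep fun n => B ^ n) {n : ℕ}
    (hn : ¬ p ∣ n) : restrictedComponent p B n = lieComponent B n := by
  refine le_antisymm ((restrictedComponent_le hB n).trans (sup_le le_rfl ?_))
    (lieComponent_le_restrictedComponent n)
  refine Submodule.span_le.mpr fun y hy => ?_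
  obtain ⟨j, x, rfl, -, -⟩ := hy
  exact absurd (dvd_mul_right p j) hn

/-- In degree `p * j`, the restricted Lie powers are spanned by the Lie powers and the `p`-th
powers of a spanning set in degree `j`. -/
theorem restrictedComponent_mul_le (hB : iSupIndep fun n => B ^ n) {j : ℕ} {ι : Type*} {v : ι → A}
    (hv : Submodule.span F (Set.range v) = restrictedComponent p B j) :
    restrictedComponent p B (p * j) ≤
      lieComponent B (p * j) ⊔ Submodule.span F (Set.range fun i => v i ^ p) := by
  refine (restrictedComponent_le hB _).trans (sup_le le_sup_left ?_)
  refine Submodule.span_le.mpr fun y hy => ?_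
  obtain ⟨j', x, hj, hx, rfl⟩ := hy
  obtain rfl := Nat.eq_of_mul_eq_mul_left hp.out.pos hj
  rw [← hv] at hx
  induction hx using Submodule.span_induction with
  | mem x hx =>
    obtain ⟨i, rfl⟩ := hx
    exact Submodule.mem_sup_right (Submodule.subset_span ⟨i, rfl⟩)
  | zero =>
    rw [zero_pow hp.out.ne_zero]
    exact zero_mem _
  | add x y hx hy hx' hy' =>
    rw [hv] at hx hy
    have := add_mem (add_mem (Submodule.mem_sup_left (add_pow_sub_mem_lieComponent hx hy)) hx') hy'
    rwa [sub_add_eq_add_sub, sub_add_cancel, sub_add_cancel] at this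
  | smul c x _ hx' =>
    rw [smul_pow]
    exact Submodule.smul_mem _ _ hx'

end Components

/-! ### Independence of p-th powers modulo the free Lie algebra -/

section PowerIndependence

variable {F V : Type*} [Field F] [AddCommGroup V] [Module F V]

/-- The identification of `T(V)` with the noncommutative polynomials in a basis of `V`. -/
noncomputable def tensorEquiv {X : Type*} (b : Module.Basis X F V) :
    TensorAlgebra F V ≃ₐ[F] MonoidAlgebra F (FreeMonoid X) :=
  (TensorAlgebra.equivFreeAlgebra b).trans FreeAlgebra.equivMonoidAlgebraFreeMonoid

theorem tensorEquiv_ι {X : Type*} (b : Module.Basis X F V) (a : X) :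
    tensorEquiv b (TensorAlgebra.ι F (b a)) = letter F a := by
  simp [tensorEquiv, FreeAlgebra.equivMonoidAlgebraFreeMonoid, letter]

theorem tensorEquiv_ι_mem_span {X : Type*} (b : Module.Basis X F V) (v : V) :
    tensorEquiv b (TensorAlgebra.ι F v) ∈ Submodule.span F (Set.range (letter F)) := by
  have h : (⊤ : Submodule F V) ≤ (Submodule.span F (Set.range (letter F))).comap
      ((tensorEquiv b).toLinearMap ∘ₗ TensorAlgebra.ι F) := by
    rw [← b.span_eq, Submodule.span_le]
    rintro _ ⟨a, rfl⟩
    exact Submodule.subset_span ⟨a, (tensorEquiv_ι b a).symm⟩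
  exact h (Submodule.mem_top (x := v))

theorem tensorEquiv_mem_lieSpan {X : Type*} (b : Module.Basis X F V) {x : TensorAlgebra F V}
    (hx : x ∈ LieSubalgebra.lieSpan F (TensorAlgebra F V)
      (LinearMap.range (TensorAlgebra.ι F : V →ₗ[F] TensorAlgebra F V) :
        Set (TensorAlgebra F V))) :
    tensorEquiv b x ∈
      LieSubalgebra.lieSpan F (MonoidAlgebra F (FreeMonoid X)) (Set.range (letter F)) := by
  refine LieSubalgebra.mem_lieSpan.mp hx ((LieSubalgebra.lieSpan F (MonoidAlgebra F (FreeMonoid X))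
    (Set.range (letter F))).comap
      ((tensorEquiv b).toAlgHom : TensorAlgebra F V →ₗ⁅F⁆ MonoidAlgebra F (FreeMonoid X))) ?_
  rintro _ ⟨v, rfl⟩
  exact LieSubalgebra.submodule_span_le_lieSpan (tensorEquiv_ι_mem_span b v)

theorem tensorEquiv_mem_homogeneous {X : Type*} (b : Module.Basis X F V) {d : ℕ}
    {x : TensorAlgebra F V}
    (hx : x ∈ LinearMap.range (TensorAlgebra.ι F : V →ₗ[F] TensorAlgebra F V) ^ d) :
    tensorEquiv b x ∈ homogeneous F X d := by
  induction d generalizing x with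
  | zero =>
    rw [pow_zero] at hx
    obtain ⟨c, rfl⟩ := Submodule.mem_one.mp hx
    rw [AlgEquiv.commutes, Algebra.algebraMap_eq_smul_one]
    exact Submodule.smul_mem _ _ one_mem_homogeneous
  | succ d ih =>
    rw [pow_succ] at hx
    refine Submodule.mul_induction_on hx ?_ ?_
    · rintro y hy _ ⟨v, rfl⟩
      rw [map_mul]
      refine mul_mem_homogeneous (ih hy) ?_
      refine (Submodule.span_le.mpr ?_) (tensorEquiv_ι_mem_span b v)
      rintro _ ⟨a, rfl⟩
      exact letter_mem_homogeneous a
    · intro y z hy hz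
      rw [map_add]
      exact add_mem hy hz

/-- Given finitely many homogeneous elements of the same degree, not all of them zero, one of
them has a word `u` with nonzero coefficient such that no smaller word occurs in any of them. -/
theorem exists_common_lead {X : Type*} [LinearOrder X] [Finite X] {ι : Type*} {s : Finset ι}
    {d : ℕ} {f : ι → MonoidAlgebra F (FreeMonoid X)} (hf : ∀ i ∈ s, f i ∈ homogeneous F X d)
    (hs : ∃ i ∈ s, f i ≠ 0) :
    ∃ u : List X, u.length = d ∧
      (∀ i ∈ s, HasLead u ((f i).coeff (FreeMonoid.ofList u)) (f i)) ∧
      ∃ i ∈ s, (f i).coeff (FreeMonoid.ofList u) ≠ 0 := by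
  let W : Set (List X) :=
    {w | w.length = d ∧ ∃ i ∈ s, (f i).coeff (FreeMonoid.ofList w) ≠ 0}
  have hfin : W.Finite := (List.finite_length_eq X d).subset fun w hw => hw.1
  have hW : W.Nonempty := by
    obtain ⟨i, hi, hne⟩ := hs
    obtain ⟨w, hw⟩ : ∃ w, (f i).coeff w ≠ 0 := by
      by_contra! h
      exact hne (MonoidAlgebra.ext (Finsupp.ext h))
    refine ⟨w.toList, ?_, i, hi, by simpa using hw⟩
    by_contra hl
    exact hw (by simpa using hf i hi w.toList hl)
  obtain ⟨u, ⟨hul, hu⟩, hmin⟩ := Set.exists_min_image W id hfin hW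
  refine ⟨u, hul, fun i hi => ⟨rfl, fun w hw hlt => ?_⟩, hu⟩
  by_contra h
  exact (hmin w ⟨hw.trans hul, i, hi, h⟩).not_gt hlt

variable [FiniteDimensional F V] {p : ℕ} [hp : Fact p.Prime] [CharP F p]

/-- The `p`-th powers of linearly independent homogeneous elements of the free restricted Lie
algebra are linearly independent modulo the free Lie algebra. -/
theorem eq_zero_of_sum_pow_mem_lieSpan {ι : Type*} (s : Finset ι) (d : ℕ) :
    ∀ (x : ι → TensorAlgebra F V), (∀ i ∈ s, x i ∈ restrictedComponent p
        (LinearMap.range (TensorAlgebra.ι F : V →ₗ[F] TensorAlgebra F V)) d) →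
      (∀ c : ι → F, ∑ i ∈ s, c i • x i = 0 → ∀ i ∈ s, c i = 0) →
      ∀ c : ι → F, ∑ i ∈ s, c i • x i ^ p ∈ LieSubalgebra.lieSpan F (TensorAlgebra F V)
        (LinearMap.range (TensorAlgebra.ι F : V →ₗ[F] TensorAlgebra F V) :
          Set (TensorAlgebra F V)) → ∀ i ∈ s, c i = 0 := by
  classical
  -- Gaussian elimination: each round uses a common leading word u to remove one element j from the
  -- family.
  induction hn : s.card generalizing s with
  | zero =>
    intro x _ _ c _ i hi
    rw [Finset.card_eq_zero.mp hn] at hi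
    exact absurd hi (Finset.notMem_empty i)
  | succ n ih =>
  intro x hx hind c hc
  let e := tensorEquiv (Module.finBasis F V)
  have hhom : ∀ i ∈ s, e (x i) ∈ homogeneous F _ d := fun i hi =>
    tensorEquiv_mem_homogeneous _ (hx i hi).2
  have hne : ∀ i ∈ s, x i ≠ 0 := by
    intro i hi h0
    have := hind (fun j => if j = i then 1 else 0) (by simp [h0]) i hi
    simp at this
  obtain ⟨i₀, hi₀⟩ : s.Nonempty := Finset.card_pos.mp (by omega)
  obtain ⟨u, rfl, hlead, j, hj, hα⟩ := exists_common_lead hhom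
    ⟨i₀, hi₀, (EmbeddingLike.map_ne_zero_iff (f := e)).mpr (hne i₀ hi₀)⟩
  set α : ι → F := fun i => (e (x i)).coeff (FreeMonoid.ofList u) with hαdef
  obtain ⟨t, hjt, rfl⟩ : ∃ t, j ∉ t ∧ s = insert j t :=
    ⟨s.erase j, Finset.notMem_erase j s, (Finset.insert_erase hj).symm⟩
  -- eliminate the leading word from the other elements
  set β : ι → F := fun i => α i / α j with hβ
  set y : ι → TensorAlgebra F V := fun i => x i - β i • x j with hy
  have hyR : ∀ i ∈ t, y i ∈ restrictedComponent p
      (LinearMap.range (TensorAlgebra.ι F : V →ₗ[F] TensorAlgebra F V)) u.length := fun i hi =>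
    sub_mem (hx i (Finset.mem_insert_of_mem hi)) (Submodule.smul_mem _ _ (hx j hj))
  have hylead : ∀ i ∈ t, HasLead u 0 (e (y i)) := by
    intro i hi
    have h := (hlead i (Finset.mem_insert_of_mem hi)).add ((hlead j hj).smul (-β i))
    have h0 : α i + -β i * α j = 0 := by
      rw [hβ, neg_mul, div_mul_cancel₀ _ hα, add_neg_cancel]
    have h1 : e (y i) = e (x i) + -β i • e (x j) := by
      rw [hy]
      simp [sub_eq_add_neg]
    rw [h1]
    rwa [← h0]
  have hmod : ∀ i ∈ t, x i ^ p - y i ^ p - β i ^ p • x j ^ p ∈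
      LieSubalgebra.lieSpan F (TensorAlgebra F V)
        (LinearMap.range (TensorAlgebra.ι F : V →ₗ[F] TensorAlgebra F V) :
          Set (TensorAlgebra F V)) := by
    intro i hi
    have h := add_pow_sub_mem_lieSpan (hyR i hi).1 (Submodule.smul_mem _ (β i) (hx j hj)).1
    rwa [hy, sub_add_cancel, smul_pow] at h
  -- The coefficient of the p-th power of x_j after substituting x_i = y_i + β_i x_j and expanding
  -- modulo the Lie algebra.
  set γ : F := c j + ∑ i ∈ t, c i * β i ^ p with hγ
  have hP : ∑ i ∈ t, c i • y i ^ p + γ • x j ^ p ∈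
      LieSubalgebra.lieSpan F (TensorAlgebra F V)
        (LinearMap.range (TensorAlgebra.ι F : V →ₗ[F] TensorAlgebra F V) :
          Set (TensorAlgebra F V)) := by
    have h := sub_mem hc (sum_mem fun i hi => SMulMemClass.smul_mem (c i) (hmod i hi))
    have h1 : ∑ i ∈ insert j t, c i • x i ^ p -
        ∑ i ∈ t, c i • (x i ^ p - y i ^ p - β i ^ p • x j ^ p) =
        ∑ i ∈ t, c i • y i ^ p + γ • x j ^ p := by
      rw [Finset.sum_insert hjt, hγ, add_smul, Finset.sum_smul]
      simp only [smul_sub, Finset.sum_sub_distrib, smul_smul]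
      abel
    rwa [h1] at h
  have hPlead : HasLead (List.replicate p u).flatten (γ * α j ^ p)
      (e (∑ i ∈ t, c i • y i ^ p + γ • x j ^ p)) := by
    have h1 := HasLead.sum t fun i hi => (((hylead i hi).pow
      (tensorEquiv_mem_homogeneous _ (hyR i hi).2) p).smul (c i))
    have h2 := ((hlead j hj).pow (hhom j hj) p).smul γ
    have h3 := h1.add h2
    simpa [zero_pow hp.out.ne_zero] using h3
  -- Only the p-th power of x_j contributes to the word u^p, so a nonzero γ would give a Lie element
  -- with a non-Lyndon leading word.
  have hγ0 : γ = 0 := by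
    by_contra hγ0
    exact not_isLyndon_flatten_replicate u hp.out.two_le
      (isLyndon_of_hasLead (tensorEquiv_mem_lieSpan _ hP) hPlead
        (mul_ne_zero hγ0 (pow_ne_zero p hα)))
  have ht : ∀ i ∈ t, c i = 0 := by
    refine ih t (by rw [Finset.card_insert_of_notMem hjt] at hn; omega) y hyR ?_ c ?_
    · intro a ha i hi
      -- A relation among the y_i, rewritten as one among the x_i; the coefficient at j collects the
      -- eliminated multiples.
      have h := hind (fun i => if i = j then -∑ i ∈ t, a i * β i else a i) ?_ i
        (Finset.mem_insert_of_mem hi)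
      · rwa [if_neg (ne_of_mem_of_not_mem hi hjt)] at h
      · rw [Finset.sum_insert hjt, if_pos rfl, ← ha, neg_smul, Finset.sum_smul, neg_add_eq_sub,
          ← Finset.sum_sub_distrib]
        · refine Finset.sum_congr rfl fun i hi => ?_
          rw [if_neg (ne_of_mem_of_not_mem hi hjt), hy, smul_sub, smul_smul]
    · simpa [hγ0] using hP
  intro i hi
  rcases Finset.mem_insert.mp hi with rfl | hi
  · rw [hγ, Finset.sum_eq_zero fun i hi => by rw [ht i hi, zero_mul], add_zero] at hγ0
    exact hγ0
  · exact ht i hi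

end PowerIndependence

/-! ### Independence and spanning in the inductive step -/

section Decomposition

theorem iSupIndep_iff_sum_eq_zero {R M ι : Type*} [Ring R] [AddCommGroup M] [Module R M]
    [Fintype ι] {N : ι → Submodule R M} :
    iSupIndep N ↔ ∀ v : ι → M, (∀ i, v i ∈ N i) → ∑ i, v i = 0 → ∀ i, v i = 0 := by
  classical
  rw [iSupIndep_iff_finsetSum_eq_zero_imp_eq_zero]
  refine ⟨fun h v hv h0 i => h Finset.univ v (fun i _ => hv i) h0 i (Finset.mem_univ i),
    fun h s v hv h0 i hi => ?_⟩
  have := h (fun i => if i ∈ s then v i else 0) (fun i => ?_) (by simpa using h0) i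
  · simpa [hi] using this
  · split_ifs with hi
    · exact hv i hi
    · exact zero_mem _

variable {F V : Type*} [Field F] [AddCommGroup V] [Module F V]

theorem iSupIndep_range_ι_pow :
    iSupIndep fun n => LinearMap.range (TensorAlgebra.ι F : V →ₗ[F] TensorAlgebra F V) ^ n :=
  (DirectSum.Decomposition.isInternal
    (fun n => LinearMap.range (TensorAlgebra.ι F : V →ₗ[F] TensorAlgebra F V) ^ n)).submodule_iSupIndep

/-- Powers of B sit in the distinct degrees rn of the graded algebra T(V). -/
theorem iSupIndep_pow_of_le {B : Submodule F (TensorAlgebra F V)} {r : ℕ} (hr : 1 ≤ r)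
    (hB : B ≤ LinearMap.range (TensorAlgebra.ι F : V →ₗ[F] TensorAlgebra F V) ^ r) :
    iSupIndep fun n => B ^ n := by
  refine (iSupIndep_range_ι_pow.comp (f := fun n => r * n)
    (fun a b h => Nat.eq_of_mul_eq_mul_left hr h)).mono fun n => ?_
  rw [Function.comp_apply, pow_mul]
  exact pow_le_pow_left' hB n

theorem restrictedComponent_le_of_le {A : Type*} [Ring A] [Algebra F A] {p : ℕ}
    {B T : Submodule F A} {r : ℕ} (h : B ≤ lieComponent T r) (n : ℕ) :
    restrictedComponent p B n ≤ restrictedComponent p T (r * n) := by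
  refine inf_le_inf ?_ ?_
  · exact restrictedLieSpan_le (fun x hx => lieSpan_le_restrictedLieSpan (h hx).1)
      fun x hx => pow_mem_restrictedLieSpan hx
  · rw [pow_mul]
    exact pow_le_pow_left' (h.trans inf_le_right) n

variable {p : ℕ} [hp : Fact p.Prime] [CharP F p]

/-- Adding `p`-th powers to independent restricted Lie powers preserves independence. -/
theorem iSupIndep_restrictedComponent_succ [FiniteDimensional F V] {m d : ℕ}
    {C : ℕ → Submodule F (TensorAlgebra F V)}
    (hC : ∀ i, iSupIndep fun n => C i ^ n)
    (hCL : ∀ i, (C i : Set (TensorAlgebra F V)) ⊆ LieSubalgebra.lieSpan F (TensorAlgebra F V)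
      (LinearMap.range (TensorAlgebra.ι F : V →ₗ[F] TensorAlgebra F V) :
        Set (TensorAlgebra F V)))
    (hlie : iSupIndep fun i : Fin (m + 2) => lieComponent (C i) (p ^ (m + 1 - (i : ℕ))))
    (hres : iSupIndep fun i : Fin (m + 1) => restrictedComponent p (C i) (p ^ (m - (i : ℕ))))
    (hd : ∀ i : Fin (m + 1), restrictedComponent p (C i) (p ^ (m - (i : ℕ))) ≤
      restrictedComponent p
        (LinearMap.range (TensorAlgebra.ι F : V →ₗ[F] TensorAlgebra F V)) d) :
    iSupIndep fun i : Fin (m + 2) => restrictedComponent p (C i) (p ^ (m + 1 - (i : ℕ))) := by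
  classical
  set N := LieSubalgebra.lieSpan F (TensorAlgebra F V)
      (LinearMap.range (TensorAlgebra.ι F : V →ₗ[F] TensorAlgebra F V) :
        Set (TensorAlgebra F V)) with hN
  have hLN : ∀ i n, lieComponent (C i) n ≤ N.toSubmodule := fun i n =>
    inf_le_left.trans (LieSubalgebra.lieSpan_le.mpr (hCL i))
  rw [iSupIndep_iff_sum_eq_zero]
  intro y hy hsum
  let b := fun i : Fin (m + 1) =>
    Module.Basis.ofVectorSpace F (restrictedComponent p (C i) (p ^ (m - (i : ℕ))))
  have hb : ∀ i : Fin (m + 1), Submodule.span F (Set.range fun a => (b i a : TensorAlgebra F V)) =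
      restrictedComponent p (C i) (p ^ (m - (i : ℕ))) := by
    intro i
    have h := congrArg (Submodule.map (Submodule.subtype _)) (b i).span_eq
    rw [Submodule.map_span, Submodule.map_top, Submodule.range_subtype, ← Set.range_comp] at h
    exact h
  have hbind : LinearIndependent F
      (fun j : Σ i : Fin (m + 1), Module.Basis.ofVectorSpaceIndex F
        (restrictedComponent p (C i) (p ^ (m - (i : ℕ)))) => (b j.1 j.2 : TensorAlgebra F V)) := by
    refine linearIndependent_iUnion_finite (f := fun i a => (b i a : TensorAlgebra F V)) ?_ ?_
    · intro i
      exact (b i).linearIndependent.map' (Submodule.subtype _) (Submodule.ker_subtype _)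
    · intro i t _ hit
      simp only [hb]
      exact (hres i).mono_right (iSup₂_le fun j hj =>
        le_iSup₂_of_le j (ne_of_mem_of_not_mem hj hit) le_rfl)
  -- split every `y i` into a Lie part and a combination of `p`-th powers of basis elements
  have hdec : ∀ i : Fin (m + 1), ∃ l ∈ lieComponent (C i) (p ^ (m + 1 - (i : ℕ))),
      ∃ c : _ →₀ F, y i.castSucc = l + c.sum fun a r => r • (b i a : TensorAlgebra F V) ^ p := by
    intro i
    have h := hy i.castSucc
    have hpow : p ^ (m + 1 - (i.castSucc : ℕ)) = p * p ^ (m - (i : ℕ)) := by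
      rw [Fin.val_castSucc, ← pow_succ', Nat.sub_add_comm (by omega)]
    rw [Fin.val_castSucc] at h hpow
    rw [hpow] at h ⊢
    obtain ⟨l, hl, z, hz, hlz⟩ :=
      Submodule.mem_sup.mp (restrictedComponent_mul_le (hC i) (hb i) h)
    obtain ⟨c, hc⟩ := Finsupp.mem_span_range_iff_exists_finsupp.mp hz
    exact ⟨l, hl, c, by rw [hc, hlz]⟩
  choose l hl c hc using hdec
  -- The new summand has degree one, so it carries no p-th powers.
  have hlast : y (Fin.last (m + 1)) ∈ lieComponent (C (m + 1)) 1 := by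
    have h := hy (Fin.last (m + 1))
    rw [Fin.val_last, Nat.sub_self, pow_zero,
      restrictedComponent_eq_lieComponent (hC _) hp.out.not_dvd_one] at h
    exact h
  -- Modulo the free Lie algebra only the p-th powers of the combined basis survive in the relation.
  have hc0 : ∀ i, c i = 0 := by
    have h := eq_zero_of_sum_pow_mem_lieSpan (p := p) (Finset.univ.sigma fun i => (c i).support) d
      (fun j => (b j.1 j.2 : TensorAlgebra F V)) (fun j _ => hd j.1 (b j.1 j.2).2)
      (fun a ha => linearIndependent_iff'.mp hbind _ a ha) (fun j => c j.1 j.2) ?_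
    · intro i
      ext a
      by_contra ha
      exact ha (h ⟨i, a⟩ (by simpa using ha))
    · rw [Finset.sum_sigma]
      have h1 : ∑ i : Fin (m + 1), ∑ a ∈ (c i).support, c i a • (b i a : TensorAlgebra F V) ^ p =
          -(∑ i, l i + y (Fin.last (m + 1))) := by
        rw [Fin.sum_univ_castSucc] at hsum
        simp only [hc, Finset.sum_add_distrib] at hsum
        rw [eq_neg_iff_add_eq_zero, ← hsum]
        simp only [Finsupp.sum]
        abel
      rw [h1]
      exact neg_mem (add_mem (sum_mem fun i _ => hLN _ _ (hl i)) (hLN _ _ hlast))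
  have hyl : ∀ i : Fin (m + 2), y i ∈ lieComponent (C i) (p ^ (m + 1 - (i : ℕ))) := by
    intro i
    induction i using Fin.lastCases with
    | last => simpa using hlast
    | cast i =>
      rw [hc, hc0, Finsupp.sum_zero_index, add_zero]
      exact hl i
  exact iSupIndep_iff_sum_eq_zero.mp hlie y hyl hsum

/-- The restricted Lie powers of `V` are spanned by those of the summands. -/
theorem iSup_restrictedComponent_succ {m k : ℕ} {C : ℕ → Submodule F (TensorAlgebra F V)}
    {T : Submodule F (TensorAlgebra F V)} (hT : iSupIndep fun n => T ^ n)
    (hC : ∀ i, C i ≤ lieComponent T (p ^ i * k))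
    (hlie : ⨆ i : Fin (m + 2), lieComponent (C i) (p ^ (m + 1 - (i : ℕ))) =
      lieComponent T (p ^ (m + 1) * k))
    (hres : ⨆ i : Fin (m + 1), restrictedComponent p (C i) (p ^ (m - (i : ℕ))) =
      restrictedComponent p T (p ^ m * k)) :
    ⨆ i : Fin (m + 2), restrictedComponent p (C i) (p ^ (m + 1 - (i : ℕ))) =
      restrictedComponent p T (p ^ (m + 1) * k) := by
  have hpow : p ^ (m + 1) * k = p * (p ^ m * k) := by rw [pow_succ', mul_assoc]
  refine le_antisymm (iSup_le fun i => ?_) ?_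
  · refine (restrictedComponent_le_of_le (hC i) _).trans_eq ?_
    rw [mul_right_comm, ← pow_add, Nat.add_sub_cancel' (by omega)]
  have hL : lieComponent T (p ^ (m + 1) * k) ≤
      ⨆ i : Fin (m + 2), restrictedComponent p (C i) (p ^ (m + 1 - (i : ℕ))) := by
    rw [← hlie]
    exact iSup_mono fun i => lieComponent_le_restrictedComponent _
  refine (restrictedComponent_le hT _).trans (sup_le hL (Submodule.span_le.mpr ?_))
  rintro _ ⟨j, x, hj, hx, rfl⟩
  obtain rfl := Nat.eq_of_mul_eq_mul_left hp.out.pos (hj.trans hpow)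
  rw [← hres] at hx
  rw [SetLike.mem_coe]
  -- A p-th power of a sum across the summands splits up to a Lie element of degree pj, which `hL`
  -- already places in the span.
  induction hx using Submodule.iSup_induction' with
  | mem i x hx =>
    refine Submodule.mem_iSup_of_mem i.castSucc ?_
    rw [Fin.val_castSucc, Nat.sub_add_comm (by omega), pow_succ']
    exact pow_mem_restrictedComponent hx
  | zero =>
    rw [zero_pow hp.out.ne_zero]
    exact zero_mem _
  | add x y hx hy hx' hy' =>
    rw [hres] at hx hy
    have h := add_pow_sub_mem_lieComponent hx hy
    rw [← hpow] at h
    have := add_mem (add_mem (hL h) hx') hy'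
    rwa [sub_add_eq_add_sub, sub_add_cancel, sub_add_cancel] at this

end Decomposition

end LiePowers

theorem theorem2p2 {F G V : Type*} [Field F] [Group G] [AddCommGroup V] [Module F V]
    [FiniteDimensional F V] (p : ℕ) [Fact p.Prime] [CharP F p]
    (ρ : Representation F G V) (B : ℕ → Subrepresentation (LiePowers.tensorRep ρ))
    (hB : LiePowers.IsLieDecomposition p ρ B) (k m : ℕ) (hk : ¬ p ∣ k) :
    LiePowers.IsDirectSumOf
      (LiePowers.restrictedLiePower p (LiePowers.base ρ) (p ^ m * k))
      (fun i : Fin (m + 1) =>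
        LiePowers.restrictedLiePower p (B (p ^ (i : ℕ) * k)) (p ^ (m - (i : ℕ)))) := by
  have hp : p.Prime := Fact.out
  have hk1 : 1 ≤ k := Nat.one_le_iff_ne_zero.mpr fun h => hk (h ▸ dvd_zero p)
  have hr : ∀ i, 1 ≤ p ^ i * k := fun i => Nat.mul_pos (pow_pos hp.pos i) hk1
  let T := LinearMap.range (TensorAlgebra.ι F : V →ₗ[F] TensorAlgebra F V)
  -- This family does not depend on m: passing from m to m + 1 multiplies the degrees in the old
  -- summands by p and appends one summand.
  let C : ℕ → Submodule F (TensorAlgebra F V) := fun i => (B (p ^ i * k)).toSubmodule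
  have hC : ∀ i, C i ≤ LiePowers.lieComponent T (p ^ i * k) := fun i =>
    hB.le_liePower _ (hr i)
  have hCi : ∀ i, iSupIndep fun n => C i ^ n := fun i =>
    LiePowers.iSupIndep_pow_of_le (hr i) ((hC i).trans inf_le_right)
  have hlie : ∀ m, iSupIndep
        (fun i : Fin (m + 1) => LiePowers.lieComponent (C i) (p ^ (m - (i : ℕ)))) ∧
      ⨆ i : Fin (m + 1), LiePowers.lieComponent (C i) (p ^ (m - (i : ℕ))) =
        LiePowers.lieComponent T (p ^ m * k) := fun m => hB.isDirectSumOf k m hk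
  change iSupIndep
        (fun i : Fin (m + 1) => LiePowers.restrictedComponent p (C i) (p ^ (m - (i : ℕ)))) ∧
      ⨆ i : Fin (m + 1), LiePowers.restrictedComponent p (C i) (p ^ (m - (i : ℕ))) =
        LiePowers.restrictedComponent p T (p ^ m * k)
  induction m with
  | zero =>
    -- For m = 0 the degrees 1 and k are prime to p, so restricted and ordinary Lie powers coincide.
    have h1 : ∀ i : Fin (0 + 1), LiePowers.restrictedComponent p (C i) (p ^ (0 - (i : ℕ))) =
        LiePowers.lieComponent (C i) (p ^ (0 - (i : ℕ))) := fun i =>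
      LiePowers.restrictedComponent_eq_lieComponent (hCi i) (by simpa using hp.one_lt.ne')
    have h2 : LiePowers.restrictedComponent p T (p ^ 0 * k) =
        LiePowers.lieComponent T (p ^ 0 * k) :=
      LiePowers.restrictedComponent_eq_lieComponent LiePowers.iSupIndep_range_ι_pow
        (by simpa using hk)
    simp only [h1, h2]
    exact hlie 0
  | succ m ih =>
    refine ⟨LiePowers.iSupIndep_restrictedComponent_succ (d := p ^ m * k) hCi
      (fun i => (hC i).trans inf_le_left) (hlie (m + 1)).1 ih.1 fun i => ?_,
      LiePowers.iSup_restrictedComponent_succ LiePowers.iSupIndep_range_ι_pow hC (hlie (m + 1)).2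
        ih.2⟩
    rw [← ih.2]
    exact le_iSup
      (fun i : Fin (m + 1) => LiePowers.restrictedComponent p (C i) (p ^ (m - (i : ℕ)))) i
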